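/- Let $p_0,p_1,p_2\ge 0$ with $p_0+p_1+p_2=1$ and let $0\le\vartheta\le\pi/2$. Let $I_\vartheta$ be the set of all $z\in(0,1)$ for which there exist unit vectors $\psi_0,\psi_1,\psi_2$ in a complex Hilbert space with $$\langle\psi_0|\psi_1\rangle=z\,e^{i\tau_{01}},\quad \langle\psi_1|\psi_2\rangle=z\,e^{i\tau_{12}},\quad \langle\psi_2|\psi_0\rangle=z\,e^{i\tau_{20}},\qquad \tau_{01}+\tau_{12}+\tau_{20}=\vartheta \qquad(\ast)$$ for some real $\tau_{01},\tau_{12},\tau_{20}$. Let $E$ be a complex Hilbert space and, for every $z\in I_\vartheta$, let $\psi_0(z),\psi_1(z),\psi_2(z)\in E$ be unit vectors satisfying $(\ast)$ for this $z$ (the individual phases may depend on $z$). Put $$\varpi(z)=\sum_{k=0}^{2}p_k\,|\psi_k(z)\rangle\langle\psi_k(z)|.$$ Then $I_\vartheta$ is an interval and the von Neumann entropy $H(\varpi(z))=-\operatorname{Tr}[\varpi(z)\log_2\varpi(z)]$ is a concave function of $z\in I_\vartheta$. Moreover, for every $z\in I_\vartheta$ there are reals $x_0\ge x_1\ge x_2\ge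 0$ with $x_0+x_1+x_2=1$ and orthonormal vectors $e_0,e_1,e_2\in E$ such that $\varpi(z)=\sum_k x_k|e_k\rangle\langle e_k|$ (so the $x_k$ are the eigenvalues of $\varpi(z)$, the remaining ones being $0$), and $H(\varpi(z))$ is the ternary Shannon entropy $h_3=-\sum_{k=0}^{2} x_k\log_2 x_k$ of these eigenvalues, where $0\log_2 0=0$. -/

import Mathlib

noncomputable section

namespace TernaryEntropy

variable {E : Type*} [NormedAddCommGroup E] [InnerProductSpace ℂ E]

/-- The Hilbert space trace `∑ᵢ ⟨bᵢ, A bᵢ⟩` over a Hilbert basis; for trace class `A`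
(in particular for `A` of finite rank) it does not depend on the basis. -/
def opTrace [CompleteSpace E] (A : E →L[ℂ] E) : ℂ :=
  ∑' i : (exists_hilbertBasis ℂ E).choose,
    inner ℂ ((exists_hilbertBasis ℂ E).choose_spec.choose i)
      (A ((exists_hilbertBasis ℂ E).choose_spec.choose i))

/-- The von Neumann entropy `-Tr[ρ log₂ ρ]`, by the continuous functional calculus applied to
the continuous function `x ↦ -x log₂ x` (with `0 log₂ 0 = 0`). -/
def vonNeumannEntropy [CompleteSpace E] (ρ : E →L[ℂ] E) : ℝ :=
  (opTrace (cfc (fun x : ℝ => -(x * Real.logb 2 x)) ρ)).re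

/-- The ternary Shannon entropy of `(u, v, 1 - u - v)`. -/
def h₃ (u v : ℝ) : ℝ :=
  -(u * Real.logb 2 u) - v * Real.logb 2 v - (1 - u - v) * Real.logb 2 (1 - u - v)

/-- The mixture `∑ₖ wₖ |φₖ⟩⟨φₖ|`. -/
def mixture (w : Fin 3 → ℝ) (φ : Fin 3 → E) : E →L[ℂ] E :=
  ∑ k, (w k : ℂ) • InnerProductSpace.rankOne ℂ (φ k) (φ k)

/-- Three unit vectors whose overlaps all have modulus `z`, i.e. `⟨ψ₀, ψ₁⟩ = z exp(i τ₀₁)`,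
`⟨ψ₁, ψ₂⟩ = z exp(i τ₁₂)`, `⟨ψ₂, ψ₀⟩ = z exp(i τ₂₀)`, and whose total phase is
`τ₀₁ + τ₁₂ + τ₂₀ = ϑ`. The index `k + 1` is taken modulo 3, and `τ k` is the phase of
`⟨ψₖ, ψₖ₊₁⟩`. -/
structure HasOverlap (ψ : Fin 3 → E) (z ϑ : ℝ) : Prop where
  norm_eq_one : ∀ k, ‖ψ k‖ = 1
  overlap : ∃ τ : Fin 3 → ℝ, ∑ k, τ k = ϑ ∧
    ∀ k, inner ℂ (ψ k) (ψ (k + 1)) = (z : ℂ) * Complex.exp (Complex.I * (τ k : ℂ))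

/-- The moduli `z ∈ (0, 1)` that occur together with the total phase `ϑ`. Three vectors of any
Hilbert space span at most three dimensions, so it suffices to look for them in `ℂ³`. -/
def overlapDomain (ϑ : ℝ) : Set ℝ :=
  {z | z ∈ Set.Ioo (0 : ℝ) 1 ∧ ∃ ψ : Fin 3 → EuclideanSpace ℂ (Fin 3), HasOverlap ψ z ϑ}

end TernaryEntropy

end

noncomputable section

namespace TernaryEntropy

open InnerProductSpace Polynomial
open scoped ComplexOrder

variable {E : Type*} [NormedAddCommGroup E] [InnerProductSpace ℂ E]

/-! Rephasing the vectors leaves the mixture unchanged and makes all three overlaps equal to `z *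
exp (I * ϑ / 3)`, so the Gram matrix is affine in `z`. The domain is cut out of `(0, 1)` by
positivity of that matrix, hence convex. If `S` sends the `k`-th basis vector of `ℂ³` to `√(p k) • φ
k`, the mixture is `S S*`; it has the same nonzero eigenvalues as `S* S`, whose quadratic form `‖S
c‖ ^ 2` is linear in the Gram matrix (`norm_synthesis_sq_combo`). With `η x = -x log₂ x`, Jensen
bounds `∑ η` of the eigenvalues by `∑ η (‖S (v j)‖ ^ 2)` in any orthonormal basis `v`
(`sum_eigenvalues_le_sum_quadratic`). Taking for `v` the eigenbasis at the intermediate point,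
concavity of `η` finishes the proof. -/

/-! ### Functional calculus and trace of diagonal operators -/

lemma mixture_apply (w : Fin 3 → ℝ) (φ : Fin 3 → E) (y : E) :
    mixture w φ y = ∑ k, (w k : ℂ) • inner ℂ (φ k) y • φ k := by
  simp [mixture]

lemma mixture_apply_self {e : Fin 3 → E} (he : Orthonormal ℂ e) (x : Fin 3 → ℝ) (k : Fin 3) :
    mixture x e (e k) = (x k : ℂ) • e k := by
  simp [mixture_apply, orthonormal_iff_ite.mp he]

lemma mixture_mul_mixture {e : Fin 3 → E} (he : Orthonormal ℂ e) (x y : Fin 3 → ℝ) :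
    mixture x e * mixture y e = mixture (x * y) e := by
  ext v
  rw [ContinuousLinearMap.mul_def, ContinuousLinearMap.comp_apply, mixture_apply y, map_sum, mixture_apply]
  refine Finset.sum_congr rfl fun k _ => ?_
  rw [map_smul, map_smul, mixture_apply_self he]
  simp only [smul_smul, Pi.mul_apply, Complex.ofReal_mul]
  congr 1
  ring

lemma mixture_pow {e : Fin 3 → E} (he : Orthonormal ℂ e) (x : Fin 3 → ℝ) (n : ℕ) :
    mixture x e ^ (n + 1) = mixture (x ^ (n + 1)) e := by
  induction n with
  | zero => simp
  | succ n ih => rw [pow_succ, ih, mixture_mul_mixture he, pow_succ x (n + 1)]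

lemma mixture_add (x y : Fin 3 → ℝ) (e : Fin 3 → E) :
    mixture (x + y) e = mixture x e + mixture y e := by
  simp [mixture, add_smul, Finset.sum_add_distrib]

lemma mixture_smul (c : ℝ) (x : Fin 3 → ℝ) (e : Fin 3 → E) :
    mixture (c • x) e = c • mixture x e := by
  ext v
  simp [mixture_apply, Finset.smul_sum, mul_smul]

lemma mixture_zero (e : Fin 3 → E) : mixture 0 e = 0 := by
  simp [mixture]

/-- Since `e` need not span `E`, the constant term acts as a scalar off the span and is split off.
-/
lemma aeval_mixture {e : Fin 3 → E} (he : Orthonormal ℂ e) (x : Fin 3 → ℝ) (q : ℝ[X]) :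
    aeval (mixture x e) q
      = q.eval 0 • (1 : E →L[ℂ] E) + mixture (fun k => q.eval (x k) - q.eval 0) e := by
  induction q using Polynomial.induction_on' with
  | add p q hp hq =>
    rw [map_add, hp, hq]
    have : (fun k => (p + q).eval (x k) - (p + q).eval 0)
        = (fun k => p.eval (x k) - p.eval 0) + fun k => q.eval (x k) - q.eval 0 := by
      ext k
      simp only [eval_add, Pi.add_apply]
      ring
    rw [this, mixture_add, eval_add, add_smul]
    abel
  | monomial n c =>
    cases n with
    | zero =>
      have : (fun k => (monomial 0 c).eval (x k) - (monomial 0 c).eval 0) = (0 : Fin 3 → ℝ) := by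
        ext k; simp
      rw [this, mixture_zero]
      simp [Algebra.algebraMap_eq_smul_one]
    | succ n =>
      have : (fun k => (monomial (n + 1) c).eval (x k) - (monomial (n + 1) c).eval 0)
          = c • x ^ (n + 1) := by
        ext k; simp
      rw [this, mixture_smul, aeval_monomial, mixture_pow he]
      simp [Algebra.algebraMap_eq_smul_one]

lemma isSelfAdjoint_mixture [CompleteSpace E] (x : Fin 3 → ℝ) (e : Fin 3 → E) :
    IsSelfAdjoint (mixture x e) := by
  simp [IsSelfAdjoint, mixture, star_sum, ContinuousLinearMap.star_eq_adjoint]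

lemma spectrum_mixture_subset {e : Fin 3 → E} (he : Orthonormal ℂ e) (x : Fin 3 → ℝ) :
    spectrum ℝ (mixture x e) ⊆ insert 0 (Set.range x) := by
  intro μ hμ
  have : Nontrivial E := ⟨e 0, 0, he.ne_zero 0⟩
  -- The factor `X` annihilates the orthogonal complement of the span of `e`.
  set q : ℝ[X] := X * ∏ k, (X - C (x k)) with hq
  have hz : aeval (mixture x e) q = 0 := by
    rw [aeval_mixture he]
    have : (fun k => q.eval (x k) - q.eval 0) = 0 := by
      ext k
      simp [hq, eval_prod, Finset.prod_eq_zero (Finset.mem_univ k)]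
    rw [this, mixture_zero]
    simp [hq]
  have := spectrum.subset_polynomial_aeval (mixture x e) q ⟨μ, hμ, rfl⟩
  rw [hz, spectrum.zero_eq] at this
  simp only [hq, eval_mul, eval_X, eval_prod, eval_sub, eval_C, Set.mem_singleton_iff,
    mul_eq_zero, Finset.prod_eq_zero_iff, sub_eq_zero] at this
  rcases this with h | ⟨k, -, h⟩
  · exact Or.inl h
  · exact Or.inr ⟨k, h.symm⟩

/-- The functional calculus acts on the eigenvalues of a finite rank diagonal operator. -/
lemma cfc_mixture [CompleteSpace E] {e : Fin 3 → E} (he : Orthonormal ℂ e) (x : Fin 3 → ℝ)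
    {f : ℝ → ℝ} (hf : f 0 = 0) :
    cfc f (mixture x e) = mixture (f ∘ x) e := by
  classical
  -- On this finite set, which contains the spectrum, `f` agrees with a polynomial; `f 0 = 0`
  -- removes the identity term.
  set s : Finset ℝ := insert 0 (Finset.univ.image x)
  set q : ℝ[X] := Lagrange.interpolate s id f
  have hq : ∀ r ∈ s, q.eval r = f r := fun r hr =>
    Lagrange.eval_interpolate_at_node f (Set.injOn_id _) hr
  have h0 : q.eval 0 = 0 := (hq 0 (by simp [s])).trans hf
  have hx : ∀ k, q.eval (x k) = f (x k) := fun k => hq _ (by simp [s])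
  rw [cfc_congr (g := q.eval), cfc_polynomial q _ (isSelfAdjoint_mixture x e), aeval_mixture he]
  · simp [h0, hx, Function.comp_def]
  · intro μ hμ
    refine (hq μ ?_).symm
    have := spectrum_mixture_subset he x hμ
    simpa [s] using this

lemma opTrace_mixture [CompleteSpace E] {e : Fin 3 → E} (he : Orthonormal ℂ e)
    (x : Fin 3 → ℝ) : opTrace (mixture x e) = ((∑ k, x k : ℝ) : ℂ) := by
  unfold opTrace
  set b := (exists_hilbertBasis ℂ E).choose_spec.choose
  have h : HasSum (fun i => ∑ k, (x k : ℂ) * (inner ℂ (e k) (b i) * inner ℂ (b i) (e k)))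
      (∑ k, (x k : ℂ) * inner ℂ (e k) (e k)) :=
    hasSum_sum fun k _ => (b.hasSum_inner_mul_inner (e k) (e k)).mul_left _
  convert h.tsum_eq using 1
  · refine tsum_congr fun i => ?_
    rw [mixture_apply, inner_sum]
    simp only [inner_smul_right]
  · simp [inner_self_eq_norm_sq_to_K, he.1]

lemma vonNeumannEntropy_mixture [CompleteSpace E] {e : Fin 3 → E} (he : Orthonormal ℂ e)
    (x : Fin 3 → ℝ) :
    vonNeumannEntropy (mixture x e) = ∑ k, -(x k * Real.logb 2 (x k)) := by
  rw [vonNeumannEntropy, cfc_mixture he x (by simp), opTrace_mixture he, Complex.ofReal_re]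
  rfl

/-! ### Singular values and Jensen's inequality -/

/-- Pairwise orthogonal vectors are multiples of orthonormal ones if there is enough room. -/
lemma exists_orthonormal_smul {w v : Fin 3 → E} (hv : LinearIndependent ℂ v)
    (hw : Pairwise fun i j => inner ℂ (w i) (w j) = 0) :
    ∃ e : Fin 3 → E, Orthonormal ℂ e ∧ ∀ k, w k = ((‖w k‖ : ℝ) : ℂ) • e k := by
  classical
  set F : Submodule ℂ E := Submodule.span ℂ (Set.range v ∪ Set.range w)
  have : FiniteDimensional ℂ F :=
    FiniteDimensional.span_of_finite ℂ ((Set.finite_range v).union (Set.finite_range w))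
  have hvF : ∀ k, v k ∈ F := fun k => Submodule.subset_span (Or.inl ⟨k, rfl⟩)
  have hwF : ∀ k, w k ∈ F := fun k => Submodule.subset_span (Or.inr ⟨k, rfl⟩)
  have hv' : LinearIndependent ℂ fun k => (⟨v k, hvF k⟩ : F) :=
    LinearIndependent.of_comp F.subtype hv
  have hcard : 3 ≤ Module.finrank ℂ F := by simpa using hv'.fintype_card_le_finrank
  set n := Module.finrank ℂ F with hn
  have hinj : Function.Injective (Fin.castLE hcard) := Fin.castLE_injective hcard
  set u : Fin 3 → F := fun k => ((‖w k‖⁻¹ : ℝ) : ℂ) • ⟨w k, hwF k⟩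
  set f : Fin n → F := Function.extend (Fin.castLE hcard) u 0
  have hf : ∀ k, f (Fin.castLE hcard k) = u k := fun k => hinj.extend_apply _ _ _
  -- Only the nonzero `w k` are prescribed; the basis extension fills the other slots.
  set s : Set (Fin n) := {i | ∃ k, Fin.castLE hcard k = i ∧ w k ≠ 0}
  have hs : Orthonormal ℂ (s.domRestrict f) := by
    constructor
    · rintro ⟨_, k, rfl, hk⟩
      have : ‖w k‖ ≠ 0 := norm_ne_zero_iff.mpr hk
      simp only [Set.domRestrict_apply, hf, u, norm_smul]
      simp [this]
    · rintro ⟨_, k, rfl, hk⟩ ⟨_, l, rfl, hl⟩ hkl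
      have hkl' : k ≠ l := by
        rintro rfl
        exact hkl rfl
      simp only [Set.domRestrict_apply, hf, u, inner_smul_left, inner_smul_right,
        Submodule.coe_inner, hw hkl', mul_zero]
  obtain ⟨b, hb⟩ := hs.exists_orthonormalBasis_extension_of_card_eq (by simp [hn])
  refine ⟨fun k => (b (Fin.castLE hcard k) : E), ?_, fun k => ?_⟩
  · exact (b.orthonormal.comp _ hinj).comp_linearIsometry F.subtypeₗᵢ
  · by_cases hk : w k = 0
    · simp [hk]
    · beta_reduce
      rw [hb _ ⟨k, rfl, hk⟩, hf]
      have : (‖w k‖ : ℂ) ≠ 0 := by simpa using hk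
      simp [u, smul_smul, this]

/-- The right side does not involve `b`, so the standard basis can be exchanged for a singular one.
-/
lemma sum_rankOne_map_orthonormalBasis [CompleteSpace E] {ι : Type*} [Fintype ι] {H : Type*} [NormedAddCommGroup H]
    [InnerProductSpace ℂ H] [CompleteSpace H] (S : H →L[ℂ] E) (b : OrthonormalBasis ι ℂ H) :
    ∑ k, rankOne ℂ (S (b k)) (S (b k)) = S ∘L S.adjoint := by
  ext y
  conv_rhs => rw [ContinuousLinearMap.comp_apply, ← b.sum_repr' (S.adjoint y), map_sum]
  simp [ContinuousLinearMap.adjoint_inner_right]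

/-- The singular value decomposition of a map from `ℂ³` to a space of dimension at least three. -/
lemma exists_singular_decomposition [CompleteSpace E]
    (S : EuclideanSpace ℂ (Fin 3) →L[ℂ] E) {v : Fin 3 → E} (hv : LinearIndependent ℂ v) :
    ∃ (x : Fin 3 → ℝ) (u : OrthonormalBasis (Fin 3) ℂ (EuclideanSpace ℂ (Fin 3)))
      (e : Fin 3 → E), Antitone x ∧ (∀ k, 0 ≤ x k) ∧ Orthonormal ℂ e ∧
        ∀ k, S (u k) = (√(x k) : ℂ) • e k := by
  have hT : ((S.adjoint ∘L S : EuclideanSpace ℂ (Fin 3) →L[ℂ] EuclideanSpace ℂ (Fin 3)) :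
      EuclideanSpace ℂ (Fin 3) →ₗ[ℂ] EuclideanSpace ℂ (Fin 3)).IsSymmetric := fun a b => by
    simp [ContinuousLinearMap.adjoint_inner_left, ContinuousLinearMap.adjoint_inner_right]
  have hn : Module.finrank ℂ (EuclideanSpace ℂ (Fin 3)) = 3 := by simp
  set x := hT.eigenvalues hn
  set u := hT.eigenvectorBasis hn
  have hin : ∀ j k, inner ℂ (S (u j)) (S (u k)) = (x k : ℂ) * inner ℂ (u j) (u k) := fun j k => by
    have := hT.apply_eigenvectorBasis hn k
    rw [← ContinuousLinearMap.adjoint_inner_right, ← inner_smul_right]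
    exact congrArg _ this
  have hnorm : ∀ k, ‖S (u k)‖ ^ 2 = x k := fun k => by
    have := hin k k
    rw [inner_self_eq_norm_sq_to_K, inner_self_eq_norm_sq_to_K, u.orthonormal.1] at this
    simp only [Complex.coe_algebraMap, Complex.ofReal_one, one_pow, mul_one] at this
    exact_mod_cast this
  obtain ⟨e, he, hwe⟩ := exists_orthonormal_smul (w := fun k => S (u k)) hv fun j k hjk => by
    simp [hin, u.orthonormal.2 hjk]
  refine ⟨x, u, e, hT.eigenvalues_antitone hn, fun k => hnorm k ▸ sq_nonneg _, he, fun k => ?_⟩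
  rw [← hnorm, Real.sqrt_sq (norm_nonneg _)]
  exact hwe k

/-- Jensen's inequality for the quadratic form of a diagonalized map. -/
lemma sum_eigenvalues_le_sum_quadratic {S : EuclideanSpace ℂ (Fin 3) →L[ℂ] E} {x : Fin 3 → ℝ}
    {u : OrthonormalBasis (Fin 3) ℂ (EuclideanSpace ℂ (Fin 3))} {e : Fin 3 → E}
    (hx : ∀ k, 0 ≤ x k) (he : Orthonormal ℂ e) (hS : ∀ k, S (u k) = (√(x k) : ℂ) • e k)
    {f : ℝ → ℝ} (hf : ConcaveOn ℝ (Set.Ici 0) f)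
    (v : OrthonormalBasis (Fin 3) ℂ (EuclideanSpace ℂ (Fin 3))) :
    ∑ k, f (x k) ≤ ∑ j, f (‖S (v j)‖ ^ 2) := by
  have hquad : ∀ c, ‖S c‖ ^ 2 = ∑ k, ‖inner ℂ (u k) c‖ ^ 2 • x k := fun c => by
    have h : S c = ∑ k, (inner ℂ (u k) c * (√(x k) : ℂ)) • e k := by
      conv_lhs => rw [← u.sum_repr' c, map_sum]
      simp [hS, mul_smul]
    have h2 := he.inner_sum (fun k => inner ℂ (u k) c * (√(x k) : ℂ))
      (fun k => inner ℂ (u k) c * (√(x k) : ℂ)) Finset.univ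
    rw [← h, inner_self_eq_norm_sq_to_K] at h2
    apply Complex.ofReal_injective
    simp only [Complex.ofReal_pow, Complex.ofReal_sum]
    refine h2.trans (Finset.sum_congr rfl fun k _ => ?_)
    rw [RCLike.conj_mul]
    have : ‖inner ℂ (u k) c * (√(x k) : ℂ)‖ ^ 2 = ‖inner ℂ (u k) c‖ ^ 2 • x k := by
      rw [norm_mul, mul_pow, Complex.norm_real, Real.norm_eq_abs, sq_abs, Real.sq_sqrt (hx k),
        smul_eq_mul]
    rw [← this]
    simp
  -- The weights are doubly stochastic: summing to 1 over `j` gives this equality, over `k` it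
  -- permits Jensen.
  calc ∑ k, f (x k) = ∑ k, ∑ j, ‖inner ℂ (u k) (v j)‖ ^ 2 • f (x k) := by
        refine Finset.sum_congr rfl fun k _ => ?_
        rw [← Finset.sum_smul, v.sum_sq_norm_inner_left, u.orthonormal.1]
        simp
    _ = ∑ j, ∑ k, ‖inner ℂ (u k) (v j)‖ ^ 2 • f (x k) := Finset.sum_comm
    _ ≤ ∑ j, f (‖S (v j)‖ ^ 2) := Finset.sum_le_sum fun j _ => by
        rw [hquad]
        refine hf.le_map_sum (fun _ _ => sq_nonneg _) ?_ fun k _ => hx k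
        rw [u.sum_sq_norm_inner_right, v.orthonormal.1]
        simp

/-! ### Mixtures as `S S*` -/

/-- The map `ℂ³ → E` that sends the `k`-th basis vector to `√(p k) • φ k`. -/
def synthesis (p : Fin 3 → ℝ) (φ : Fin 3 → E) : EuclideanSpace ℂ (Fin 3) →L[ℂ] E :=
  ∑ k, (EuclideanSpace.proj k).smulRight ((√(p k) : ℂ) • φ k)

lemma synthesis_apply (p : Fin 3 → ℝ) (φ : Fin 3 → E) (c : EuclideanSpace ℂ (Fin 3)) :
    synthesis p φ c = ∑ k, (c k * (√(p k) : ℂ)) • φ k := by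
  simp [synthesis, mul_smul]

lemma synthesis_single (p : Fin 3 → ℝ) (φ : Fin 3 → E) (k : Fin 3) :
    synthesis p φ (EuclideanSpace.basisFun (Fin 3) ℂ k) = (√(p k) : ℂ) • φ k := by
  simp [synthesis_apply]

lemma sqrt_smul_rankOne {r : ℝ} (hr : 0 ≤ r) (y : E) :
    rankOne ℂ ((√r : ℂ) • y) ((√r : ℂ) • y) = (r : ℂ) • rankOne ℂ y y := by
  ext c
  simp only [rankOne_apply, inner_smul_left, Complex.conj_ofReal, smul_smul,
    _root_.smul_apply]
  congr 1
  rw [mul_right_comm, ← Complex.ofReal_mul, Real.mul_self_sqrt hr]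

lemma mixture_eq_synthesis [CompleteSpace E] {p : Fin 3 → ℝ} (hp : ∀ k, 0 ≤ p k) (φ : Fin 3 → E) :
    mixture p φ = synthesis p φ ∘L (synthesis p φ).adjoint := by
  rw [← sum_rankOne_map_orthonormalBasis _ (EuclideanSpace.basisFun (Fin 3) ℂ)]
  simp only [synthesis_single, sqrt_smul_rankOne (hp _)]
  rfl

lemma mixture_eq_mixture_of_singular [CompleteSpace E] {p : Fin 3 → ℝ}
    (hp : ∀ k, 0 ≤ p k) {φ : Fin 3 → E}
    {x : Fin 3 → ℝ} {u : OrthonormalBasis (Fin 3) ℂ (EuclideanSpace ℂ (Fin 3))} {e : Fin 3 → E}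
    (hx : ∀ k, 0 ≤ x k) (hS : ∀ k, synthesis p φ (u k) = (√(x k) : ℂ) • e k) :
    mixture p φ = mixture x e := by
  rw [mixture_eq_synthesis hp, ← sum_rankOne_map_orthonormalBasis _ u]
  simp only [hS, sqrt_smul_rankOne (hx _)]
  rfl

/-! ### Gram matrices and the domain of overlaps -/

/-- The Gram matrix `1 + z K` of three unit vectors `φ` with `⟨φₖ, φₖ₊₁⟩ = z w`. -/
def overlapGram (w : ℂ) (z : ℝ) : Matrix (Fin 3) (Fin 3) ℂ :=
  !![1, z * w, z * star w; z * star w, 1, z * w; z * w, z * star w, 1]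

lemma overlapGram_combo (w : ℂ) (x y : ℝ) {a b : ℝ} (hab : a + b = 1) :
    overlapGram w (a * x + b * y) = (a : ℂ) • overlapGram w x + (b : ℂ) • overlapGram w y := by
  have h : (1 : ℂ) = a + b := by exact_mod_cast hab.symm
  ext i j
  fin_cases i <;> fin_cases j <;> simp [overlapGram] <;>
    first | exact h | ring

lemma gram_eq_overlapGram {φ : Fin 3 → E} {w : ℂ} {z : ℝ} (hn : ∀ k, ‖φ k‖ = 1)
    (ho : ∀ k, inner ℂ (φ k) (φ (k + 1)) = z * w) : Matrix.gram ℂ φ = overlapGram w z := by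
  have h0 := ho 0
  have h1 := ho 1
  have h2 := ho 2
  simp only [Fin.isValue, zero_add, show (1 : Fin 3) + 1 = 2 from rfl,
    show (2 : Fin 3) + 1 = 0 from rfl] at h0 h1 h2
  have h0' : inner ℂ (φ 1) (φ 0) = z * star w := by
    rw [← inner_conj_symm, h0]; simp
  have h1' : inner ℂ (φ 2) (φ 1) = z * star w := by
    rw [← inner_conj_symm, h1]; simp
  have h2' : inner ℂ (φ 0) (φ 2) = z * star w := by
    rw [← inner_conj_symm, h2]; simp
  ext i j
  fin_cases i <;> fin_cases j <;>
    simp [overlapGram, Matrix.gram_apply, h0, h1, h2, h0', h1', h2', hn,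
      inner_self_eq_norm_sq_to_K]

lemma posDef_overlapGram_quarter {w : ℂ} (hw : ‖w‖ = 1) : (overlapGram w (1 / 4)).PosDef := by
  have hww : star w * w = 1 := by
    have := Complex.conj_mul' w
    simpa [hw] using this
  -- Chosen so that `B* B = 2 + K`, whence `1 + K / 4 = 1 / 2 + B* B / 4`.
  set B : Matrix (Fin 3) (Fin 3) ℂ := !![1, w, 0; 0, 1, w; w, 0, 1]
  have h : overlapGram w (1 / 4) = (1 / 2 : ℝ) • (1 : Matrix (Fin 3) (Fin 3) ℂ)
      + (1 / 4 : ℝ) • (B.conjTranspose * B) := by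
    ext i j
    fin_cases i <;> fin_cases j <;>
      simp [overlapGram, B, Matrix.mul_apply, Fin.sum_univ_three] <;>
      simp only [Complex.star_def] at hww <;> rw [hww] <;> norm_num
  rw [h]
  exact (Matrix.PosDef.one.smul (by norm_num)).add_posSemidef
    ((Matrix.posSemidef_conjTranspose_mul_self B).smul (by norm_num))

open scoped MatrixOrder in
lemma exists_gram_eq_of_posSemidef {G : Matrix (Fin 3) (Fin 3) ℂ} (hG : G.PosSemidef) :
    ∃ φ : Fin 3 → EuclideanSpace ℂ (Fin 3), Matrix.gram ℂ φ = G := by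
  obtain ⟨B, hB⟩ := CStarAlgebra.nonneg_iff_eq_star_mul_self.mp hG.nonneg
  refine ⟨fun k => WithLp.toLp 2 fun m => B m k, ?_⟩
  ext i j
  rw [hB, Matrix.mul_apply]
  simp [Matrix.gram_apply, PiLp.inner_apply, mul_comm]

/-- The common phase of the overlaps after a change of the phases of the vectors. -/
def meanPhase (ϑ : ℝ) : ℂ := Complex.exp (Complex.I * ((ϑ / 3 : ℝ) : ℂ))

lemma norm_meanPhase (ϑ : ℝ) : ‖meanPhase ϑ‖ = 1 := by
  rw [meanPhase, mul_comm]
  exact Complex.norm_exp_ofReal_mul_I _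

/-- Only the total phase matters: the three overlaps can be made equal by multiplying the vectors
by phases, which changes no mixture of them. -/
lemma HasOverlap.exists_rephase {ψ : Fin 3 → E} {z ϑ : ℝ} (h : HasOverlap ψ z ϑ) :
    ∃ φ : Fin 3 → E, Matrix.gram ℂ φ = overlapGram (meanPhase ϑ) z ∧
      ∀ p : Fin 3 → ℝ, mixture p ψ = mixture p φ := by
  obtain ⟨τ, hτ, ho⟩ := h.overlap
  -- Solves `hα` recursively from `α 0 = 0`; the closing equation, `k = 2`, is the total phase
  -- condition.
  set α : Fin 3 → ℝ := ![0, ϑ / 3 - τ 0, 2 * (ϑ / 3) - τ 0 - τ 1]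
  have hα : ∀ k, τ k - α k + α (k + 1) = ϑ / 3 := by
    rw [Fin.sum_univ_three] at hτ
    intro k
    fin_cases k
    · simp [α]
    · simp [α]; ring
    · simp [α]; linarith
  set c : Fin 3 → ℂ := fun k => Complex.exp (Complex.I * (α k : ℂ))
  have hc : ∀ k, ‖c k‖ = 1 := fun k => by
    simp only [c, mul_comm Complex.I]
    exact Complex.norm_exp_ofReal_mul_I _
  have hconj : ∀ k, (starRingEnd ℂ) (c k) = Complex.exp (Complex.I * ((-α k : ℝ) : ℂ)) :=
    fun k => by
      rw [← Complex.exp_conj]; simp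
  refine ⟨fun k => c k • ψ k, gram_eq_overlapGram (fun k => ?_) (fun k => ?_), fun p => ?_⟩
  · rw [norm_smul, hc, h.norm_eq_one, one_mul]
  · rw [inner_smul_left, inner_smul_right, ho, hconj, meanPhase, ← hα k]
    simp only [c]
    rw [mul_left_comm, mul_left_comm _ (z : ℂ), mul_left_comm _ (z : ℂ), ← Complex.exp_add,
      ← Complex.exp_add]
    congr 2
    push_cast
    ring
  · refine Finset.sum_congr rfl fun k _ => ?_
    congr 1
    ext y
    simp only [rankOne_apply, inner_smul_left, smul_smul]
    rw [mul_right_comm, Complex.conj_mul', hc]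
    simp

lemma hasOverlap_of_gram {φ : Fin 3 → E} {z ϑ : ℝ}
    (h : Matrix.gram ℂ φ = overlapGram (meanPhase ϑ) z) : HasOverlap φ z ϑ := by
  have hg : ∀ i j, inner ℂ (φ i) (φ j) = overlapGram (meanPhase ϑ) z i j := fun i j => by
    rw [← h, Matrix.gram_apply]
  refine ⟨fun k => ?_, fun _ => ϑ / 3, ?_, fun k => ?_⟩
  · have h1 : inner ℂ (φ k) (φ k) = 1 := by
      rw [hg]; fin_cases k <;> simp [overlapGram]
    rw [norm_eq_sqrt_re_inner (𝕜 := ℂ), h1]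
    simp
  · rw [Fin.sum_univ_three]; ring
  · rw [hg]
    fin_cases k <;> simp [overlapGram, meanPhase]

lemma mem_overlapDomain_iff {z ϑ : ℝ} :
    z ∈ overlapDomain ϑ ↔ z ∈ Set.Ioo 0 1 ∧ (overlapGram (meanPhase ϑ) z).PosSemidef := by
  refine and_congr_right fun _ => ⟨?_, fun h => ?_⟩
  · rintro ⟨ψ, hψ⟩
    obtain ⟨φ, hφ, -⟩ := hψ.exists_rephase
    exact hφ ▸ Matrix.posSemidef_gram ℂ φ
  · obtain ⟨φ, hφ⟩ := exists_gram_eq_of_posSemidef h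
    exact ⟨φ, hasOverlap_of_gram hφ⟩

lemma convex_overlapDomain (ϑ : ℝ) : Convex ℝ (overlapDomain ϑ) := by
  intro x hx y hy a b ha hb hab
  rw [mem_overlapDomain_iff] at hx hy ⊢
  refine ⟨convex_Ioo 0 1 hx.1 hy.1 ha hb hab, ?_⟩
  rw [smul_eq_mul, smul_eq_mul, overlapGram_combo _ _ _ hab]
  exact (hx.2.smul (by exact_mod_cast ha)).add (hy.2.smul (by exact_mod_cast hb))

lemma quarter_mem_overlapDomain (ϑ : ℝ) : 1 / 4 ∈ overlapDomain ϑ :=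
  mem_overlapDomain_iff.mpr ⟨by norm_num,
    (posDef_overlapGram_quarter (norm_meanPhase ϑ)).posSemidef⟩

/-! ### Concavity of the entropy in the Gram matrix -/

lemma norm_synthesis_sq (p : Fin 3 → ℝ) (φ : Fin 3 → E) (c : EuclideanSpace ℂ (Fin 3)) :
    ((‖synthesis p φ c‖ ^ 2 : ℝ) : ℂ) = ∑ i, ∑ j,
      star (c i * (√(p i) : ℂ)) * (c j * (√(p j) : ℂ)) * Matrix.gram ℂ φ i j := by
  have : ((‖synthesis p φ c‖ ^ 2 : ℝ) : ℂ) = inner ℂ (synthesis p φ c) (synthesis p φ c) := by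
    rw [inner_self_eq_norm_sq_to_K]; simp
  rw [this, synthesis_apply, sum_inner]
  refine Finset.sum_congr rfl fun i _ => ?_
  rw [inner_sum]
  refine Finset.sum_congr rfl fun j _ => ?_
  rw [inner_smul_left, inner_smul_right, Matrix.gram_apply, starRingEnd_apply]
  simp only [mul_assoc]

lemma norm_synthesis_sq_combo (p : Fin 3 → ℝ) {φ φ₁ φ₂ : Fin 3 → E} {a b : ℝ}
    (h : Matrix.gram ℂ φ = (a : ℂ) • Matrix.gram ℂ φ₁ + (b : ℂ) • Matrix.gram ℂ φ₂)
    (c : EuclideanSpace ℂ (Fin 3)) :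
    ‖synthesis p φ c‖ ^ 2 = a * ‖synthesis p φ₁ c‖ ^ 2 + b * ‖synthesis p φ₂ c‖ ^ 2 := by
  apply Complex.ofReal_injective
  rw [Complex.ofReal_add, Complex.ofReal_mul, Complex.ofReal_mul, norm_synthesis_sq,
    norm_synthesis_sq, norm_synthesis_sq, h]
  simp only [Finset.mul_sum, ← Finset.sum_add_distrib]
  refine Finset.sum_congr rfl fun i _ => Finset.sum_congr rfl fun j _ => ?_
  simp only [Matrix.add_apply, Matrix.smul_apply, smul_eq_mul]
  ring

lemma concaveOn_neg_mul_logb : ConcaveOn ℝ (Set.Ici 0) fun x : ℝ => -(x * Real.logb 2 x) := by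
  have h := Real.concaveOn_negMulLog.smul (c := (Real.log 2)⁻¹)
    (inv_nonneg.mpr (Real.log_nonneg one_le_two))
  refine h.congr fun x _ => ?_
  simp only [Real.negMulLog, Real.logb, smul_eq_mul, div_eq_inv_mul]
  ring

/-- The eigenvalues and eigenvectors of a mixture of three vectors. -/
lemma exists_eigen_decomposition [CompleteSpace E] {p : Fin 3 → ℝ} (hp : ∀ k, 0 ≤ p k)
    (φ : Fin 3 → E) {v : Fin 3 → E} (hv : LinearIndependent ℂ v) :
    ∃ (x : Fin 3 → ℝ) (u : OrthonormalBasis (Fin 3) ℂ (EuclideanSpace ℂ (Fin 3)))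
      (e : Fin 3 → E), Antitone x ∧ (∀ k, 0 ≤ x k) ∧ Orthonormal ℂ e ∧
        (∀ k, synthesis p φ (u k) = (√(x k) : ℂ) • e k) ∧ mixture p φ = mixture x e := by
  obtain ⟨x, u, e, hx, hx0, he, hS⟩ := exists_singular_decomposition (synthesis p φ) hv
  exact ⟨x, u, e, hx, hx0, he, hS, mixture_eq_mixture_of_singular hp hx0 hS⟩

/-- Equality of traces, from Jensen applied to the identity and to its negative. -/
lemma sum_eigenvalues_eq {p x : Fin 3 → ℝ} {φ e : Fin 3 → E}
    (hp : ∀ k, 0 ≤ p k) (hφ : ∀ k, ‖φ k‖ = 1) (hx : ∀ k, 0 ≤ x k) (he : Orthonormal ℂ e)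
    {u : OrthonormalBasis (Fin 3) ℂ (EuclideanSpace ℂ (Fin 3))}
    (hS : ∀ k, synthesis p φ (u k) = (√(x k) : ℂ) • e k) : ∑ k, x k = ∑ k, p k := by
  have hs : ∀ j, ‖synthesis p φ (EuclideanSpace.basisFun (Fin 3) ℂ j)‖ ^ 2 = p j := fun j => by
    rw [synthesis_single, norm_smul, hφ, mul_one, Complex.norm_real, Real.norm_eq_abs, sq_abs,
      Real.sq_sqrt (hp j)]
  have h1 := sum_eigenvalues_le_sum_quadratic hx he hS (concaveOn_id (convex_Ici 0))
    (EuclideanSpace.basisFun (Fin 3) ℂ)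
  have h2 := sum_eigenvalues_le_sum_quadratic hx he hS (convexOn_id (convex_Ici 0)).neg
    (EuclideanSpace.basisFun (Fin 3) ℂ)
  simp only [hs, id, Pi.neg_apply, Finset.sum_neg_distrib, neg_le_neg_iff] at h1 h2
  exact le_antisymm h1 h2

/-- Concavity of the entropy with respect to the Gram matrix. -/
lemma vonNeumannEntropy_concave_gram [CompleteSpace E] {p : Fin 3 → ℝ} (hp : ∀ k, 0 ≤ p k)
    {v : Fin 3 → E} (hv : LinearIndependent ℂ v) {φ φ₁ φ₂ : Fin 3 → E} {a b : ℝ}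
    (ha : 0 ≤ a) (hb : 0 ≤ b) (hab : a + b = 1)
    (h : Matrix.gram ℂ φ = (a : ℂ) • Matrix.gram ℂ φ₁ + (b : ℂ) • Matrix.gram ℂ φ₂) :
    a * vonNeumannEntropy (mixture p φ₁) + b * vonNeumannEntropy (mixture p φ₂)
      ≤ vonNeumannEntropy (mixture p φ) := by
  obtain ⟨x, u, e, -, hx, he, hS, hm⟩ := exists_eigen_decomposition hp φ hv
  obtain ⟨x₁, u₁, e₁, -, hx₁, he₁, hS₁, hm₁⟩ := exists_eigen_decomposition hp φ₁ hv
  obtain ⟨x₂, u₂, e₂, -, hx₂, he₂, hS₂, hm₂⟩ := exists_eigen_decomposition hp φ₂ hv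
  rw [hm, hm₁, hm₂, vonNeumannEntropy_mixture he, vonNeumannEntropy_mixture he₁,
    vonNeumannEntropy_mixture he₂]
  -- Both bounds use the eigenbasis `u` belonging to `φ`, not `u₁` or `u₂`.
  have h₁ := sum_eigenvalues_le_sum_quadratic hx₁ he₁ hS₁ concaveOn_neg_mul_logb u
  have h₂ := sum_eigenvalues_le_sum_quadratic hx₂ he₂ hS₂ concaveOn_neg_mul_logb u
  have hxk : ∀ k, x k = a * ‖synthesis p φ₁ (u k)‖ ^ 2 + b * ‖synthesis p φ₂ (u k)‖ ^ 2 :=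
    fun k => by
      rw [← norm_synthesis_sq_combo p h, hS, norm_smul, he.1, mul_one, Complex.norm_real,
        Real.norm_eq_abs, sq_abs, Real.sq_sqrt (hx k)]
  refine (add_le_add (mul_le_mul_of_nonneg_left h₁ ha) (mul_le_mul_of_nonneg_left h₂ hb)).trans ?_
  rw [Finset.mul_sum, Finset.mul_sum, ← Finset.sum_add_distrib]
  refine Finset.sum_le_sum fun k _ => ?_
  rw [hxk k]
  exact concaveOn_neg_mul_logb.2 (Set.mem_Ici.mpr (sq_nonneg _)) (Set.mem_Ici.mpr (sq_nonneg _))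
    ha hb hab

end TernaryEntropy

end

theorem mainTheorem2 {E : Type*} [NormedAddCommGroup E] [InnerProductSpace ℂ E] [CompleteSpace E]
    (p : Fin 3 → ℝ) (hp : ∀ k, 0 ≤ p k) (hp_sum : ∑ k, p k = 1)
    (ϑ : ℝ) (hϑ : ϑ ∈ Set.Icc 0 (Real.pi / 2))
    (ψ : ℝ → Fin 3 → E)
    (hψ : ∀ z ∈ TernaryEntropy.overlapDomain ϑ, TernaryEntropy.HasOverlap (ψ z) z ϑ) :
    ConcaveOn ℝ (TernaryEntropy.overlapDomain ϑ)
      (fun z => TernaryEntropy.vonNeumannEntropy (TernaryEntropy.mixture p (ψ z))) ∧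
    ∀ z ∈ TernaryEntropy.overlapDomain ϑ,
      ∃ (x : Fin 3 → ℝ) (e : Fin 3 → E),
        x 1 ≤ x 0 ∧ x 2 ≤ x 1 ∧ 0 ≤ x 2 ∧ ∑ k, x k = 1 ∧ Orthonormal ℂ e ∧
        TernaryEntropy.mixture p (ψ z) = TernaryEntropy.mixture x e ∧
        TernaryEntropy.vonNeumannEntropy (TernaryEntropy.mixture p (ψ z)) =
          TernaryEntropy.h₃ (x 1) (x 2) := by
  open TernaryEntropy in
  -- The family at `z = 1 / 4` is independent, so `E` has room for three orthonormal vectors even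
  -- where the Gram matrix degenerates.
  obtain ⟨v, hv, -⟩ := (hψ _ (quarter_mem_overlapDomain ϑ)).exists_rephase
  have hli : LinearIndependent ℂ v := Matrix.linearIndependent_of_posDef_gram
    (hv ▸ posDef_overlapGram_quarter (norm_meanPhase ϑ))
  refine ⟨⟨convex_overlapDomain ϑ, fun y hy z hz a b ha hb hab => ?_⟩, fun z hz => ?_⟩
  · obtain ⟨φ₁, hφ₁, hm₁⟩ := (hψ y hy).exists_rephase
    obtain ⟨φ₂, hφ₂, hm₂⟩ := (hψ z hz).exists_rephase
    obtain ⟨φ, hφ, hm⟩ :=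
      (hψ _ (convex_overlapDomain ϑ hy hz ha hb hab)).exists_rephase
    beta_reduce
    rw [hm₁, hm₂, hm]
    refine vonNeumannEntropy_concave_gram hp hli ha hb hab ?_
    rw [hφ, hφ₁, hφ₂]
    exact overlapGram_combo _ _ _ hab
  · obtain ⟨x, u, e, hanti, hx, he, hS, hm⟩ := exists_eigen_decomposition hp (ψ z) hli
    have hsum : ∑ k, x k = 1 :=
      (sum_eigenvalues_eq hp (hψ z hz).norm_eq_one hx he hS).trans hp_sum
    refine ⟨x, e, hanti (by decide), hanti (by decide), hx 2, hsum, he, hm, ?_⟩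
    rw [hm, vonNeumannEntropy_mixture he, h₃, Fin.sum_univ_three]
    rw [Fin.sum_univ_three] at hsum
    rw [show 1 - x 1 - x 2 = x 0 by linarith]
    ring
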